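/- All graphs are finite and simple. A graph $G$ contains a graph $H$ as an immersion if there are an injective map $\phi\colon V(H)\to V(G)$ and, for every edge $uv\in E(H)$, a path $P_{uv}$ in $G$ with endpoints $\phi(u)$ and $\phi(v)$, such that the paths $P_{uv}$, $uv\in E(H)$, are pairwise edge-disjoint and no vertex of $\phi(V(H))$ is an interior vertex of any of these paths. The house graph is the graph on five vertices $v_0,\dots,v_4$ with edges $v_0v_1, v_1v_2, v_2v_3, v_3v_0, v_0v_4, v_1v_4$; a graph is house-free if it has no induced subgraph isomorphic to the house graph. Let $\alpha(G)$ denote the independence number of $G$. Theorem. Let $G$ be a house-free graph on $n$ vertices with $\alpha(G)\le 2$. Then $G$ contains the complete graph $K_{\lceil n/2\rceil}$ as an immersion. -/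

import Mathlib

/-- `G.ContainsImmersion H`: the graph `G` contains the graph `H` as an immersion. The map `φ` sends
the vertices of `H` to the branch vertices, and `P` assigns to each edge `uv` of `H` a path of `G`
between `φ u` and `φ v`; the paths for `uv` and `vu` are the same path, traversed in opposite
directions. -/
def SimpleGraph.ContainsImmersion {V W : Type*} (G : SimpleGraph V) (H : SimpleGraph W) : Prop :=
  ∃ (φ : W → V) (P : ∀ u v : W, H.Adj u v → G.Walk (φ u) (φ v)),
    Function.Injective φ ∧
    (∀ (u v : W) (h : H.Adj u v), P v u h.symm = (P u v h).reverse) ∧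
    (∀ (u v : W) (h : H.Adj u v), (P u v h).IsPath) ∧
    -- paths of distinct edges are edge-disjoint
    (∀ (u v u' v' : W) (h : H.Adj u v) (h' : H.Adj u' v'), s(u, v) ≠ s(u', v') →
      (P u v h).edges.Disjoint (P u' v' h').edges) ∧
    -- no branch vertex is an interior vertex of a path
    (∀ (u v : W) (h : H.Adj u v) (w : W), φ w ∈ (P u v h).support → φ w = φ u ∨ φ w = φ v)

/-- The house graph: the 4-cycle `0123` and a vertex `4` (the roof) adjacent to exactly
`0` and `1`. -/
def houseGraph : SimpleGraph (Fin 5) :=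
  SimpleGraph.fromEdgeSet {s(0, 1), s(1, 2), s(2, 3), s(3, 0), s(0, 4), s(1, 4)}

/-! In the complement, `α(G) ≤ 2` forbids triangles and house-freeness forbids induced paths on five
vertices. Each component of such a complement is either bipartite or made of five independent sets
around a 5-cycle, with edges only between consecutive sets. Distinct components are completely
joined in `G`, so by `CliqueModelOn.join` it is enough to find, in one component `U`, a clique
immersion with at least `|U|/2` branch vertices. A bipartite component has its larger side as a
clique of `G`. In the five-set case two non-consecutive sets form a clique, and
`CliqueModelOn.of_cyclic` adds vertices of a third by routing paths of length three through the
other two. -/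

namespace SimpleGraph

variable {V : Type*} {G : SimpleGraph V}

/-- A clique immersion in `G` with branch set `S` and all paths inside `T`. The map `h` labels the
vertices so that every edge of the path between `u` and `v` is mapped to `s(u, v)`; this makes the
paths edge-disjoint and keeps branch vertices out of their interiors. -/
def CliqueModelOn (G : SimpleGraph V) (T S : Finset V) : Prop :=
  S ⊆ T ∧ ∃ h : V → V, (∀ u ∈ S, h u = u) ∧ ∀ u ∈ S, ∀ v ∈ S, u ≠ v →
    ∃ p : G.Walk u v, (∀ x ∈ p.support, x ∈ T) ∧ ∀ e ∈ p.edges, e.map h = s(u, v)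

theorem CliqueModelOn.of_isClique {T S : Finset V} (hST : S ⊆ T)
    (hS : ∀ u ∈ S, ∀ v ∈ S, u ≠ v → G.Adj u v) : G.CliqueModelOn T S := by
  refine ⟨hST, id, fun _ _ => rfl, fun u hu v hv huv => ⟨(hS u hu v hv huv).toWalk, ?_, ?_⟩⟩
  · simp [hST hu, hST hv]
  · simp

/-- Each old walk stays in its own `Tᵢ`, so gluing the two labellings leaves its edge labels
unchanged; a cross pair is a single edge with both ends fixed. -/
theorem CliqueModelOn.join [DecidableEq V] {T₁ T₂ S₁ S₂ : Finset V} (h₁ : G.CliqueModelOn T₁ S₁)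
    (h₂ : G.CliqueModelOn T₂ S₂) (hdisj : Disjoint T₁ T₂)
    (hadj : ∀ u ∈ T₁, ∀ v ∈ T₂, G.Adj u v) : G.CliqueModelOn (T₁ ∪ T₂) (S₁ ∪ S₂) := by
  obtain ⟨hs₁, f₁, hf₁, hp₁⟩ := h₁
  obtain ⟨hs₂, f₂, hf₂, hp₂⟩ := h₂
  have hnot : ∀ x ∈ T₂, x ∉ T₁ := fun x hx hx' => Finset.disjoint_left.mp hdisj hx' hx
  set f : V → V := fun x => if x ∈ T₁ then f₁ x else f₂ x with hf
  have e₁ : ∀ x ∈ T₁, f x = f₁ x := fun x hx => by simp [hf, hx]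
  have e₂ : ∀ x ∈ T₂, f x = f₂ x := fun x hx => by simp [hf, hnot x hx]
  have fix₁ : ∀ x ∈ S₁, f x = x := fun x hx => by rw [e₁ x (hs₁ hx), hf₁ x hx]
  have fix₂ : ∀ x ∈ S₂, f x = x := fun x hx => by rw [e₂ x (hs₂ hx), hf₂ x hx]
  refine ⟨Finset.union_subset_union hs₁ hs₂, f, ?_, ?_⟩
  · intro u hu
    rcases Finset.mem_union.mp hu with hu | hu
    exacts [fix₁ u hu, fix₂ u hu]
  intro u hu v hv huv
  rcases Finset.mem_union.mp hu with hu | hu <;> rcases Finset.mem_union.mp hv with hv | hv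
  · obtain ⟨p, hpT, hpe⟩ := hp₁ u hu v hv huv
    refine ⟨p, fun x hx => Finset.mem_union_left _ (hpT x hx), fun e he => ?_⟩
    rw [← hpe e he]
    induction e with
    | h x y =>
      rw [Sym2.map_mk, Sym2.map_mk, e₁ x (hpT x (p.fst_mem_support_of_mem_edges he)),
        e₁ y (hpT y (p.snd_mem_support_of_mem_edges he))]
  · have := hadj u (hs₁ hu) v (hs₂ hv)
    refine ⟨this.toWalk, ?_, ?_⟩
    · simp [hs₁ hu, hs₂ hv]
    · simp [fix₁ u hu, fix₂ v hv]
  · have := (hadj v (hs₁ hv) u (hs₂ hu)).symm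
    refine ⟨this.toWalk, ?_, ?_⟩
    · simp [hs₁ hv, hs₂ hu]
    · simp [fix₁ v hv, fix₂ u hu]
  · obtain ⟨p, hpT, hpe⟩ := hp₂ u hu v hv huv
    refine ⟨p, fun x hx => Finset.mem_union_right _ (hpT x hx), fun e he => ?_⟩
    rw [← hpe e he]
    induction e with
    | h x y =>
      rw [Sym2.map_mk, Sym2.map_mk, e₂ x (hpT x (p.fst_mem_support_of_mem_edges he)),
        e₂ y (hpT y (p.snd_mem_support_of_mem_edges he))]

/-! ### Five cliques in cyclic order -/

theorem exists_surjOn_of_card_le {s t : Finset V} (h : s.card ≤ t.card) :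
    ∃ r : V → V, ∀ y ∈ s, ∃ u ∈ t, r u = y := by
  classical
  obtain ⟨t', ht', hcard⟩ := Finset.exists_subset_card_eq h
  let e := Finset.equivOfCardEq hcard
  refine ⟨fun u => if hu : u ∈ t' then e ⟨u, hu⟩ else u, fun y hy => ?_⟩
  exact ⟨e.symm ⟨y, hy⟩, ht' (e.symm ⟨y, hy⟩).2, by simp⟩

/-- Five cliques `A, B, C, D, E`, cyclically complete to each other: the vertices of `A ∪ B ∪ X`
with `X ⊆ C` are branch vertices, and `X` is linked to `A` through `D` and `E`. -/
theorem CliqueModelOn.of_cyclic [DecidableEq V] {T A B C D E X : Finset V}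
    (hA : A ⊆ T) (hB : B ⊆ T) (hC : C ⊆ T) (hD : D ⊆ T) (hE : E ⊆ T)
    (hAB : ∀ u ∈ A ∪ B, ∀ v ∈ A ∪ B, u ≠ v → G.Adj u v)
    (hBC : ∀ u ∈ B ∪ C, ∀ v ∈ B ∪ C, u ≠ v → G.Adj u v)
    (hCD : ∀ u ∈ C ∪ D, ∀ v ∈ C ∪ D, u ≠ v → G.Adj u v)
    (hDE : ∀ u ∈ D ∪ E, ∀ v ∈ D ∪ E, u ≠ v → G.Adj u v)
    (hEA : ∀ u ∈ E ∪ A, ∀ v ∈ E ∪ A, u ≠ v → G.Adj u v)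
    (dAD : Disjoint A D) (dAE : Disjoint A E) (dBD : Disjoint B D) (dBE : Disjoint B E)
    (dCD : Disjoint C D) (dCE : Disjoint C E) (dDE : Disjoint D E)
    (hcard : A.card ≤ D.card) (hX : X ⊆ C) (hXE : X.card ≤ E.card) :
    G.CliqueModelOn T (A ∪ B ∪ X) := by
  obtain ⟨r, hr⟩ := exists_surjOn_of_card_le hcard
  obtain ⟨q, hq⟩ := exists_surjOn_of_card_le hXE
  rw [Finset.disjoint_left] at *
  -- `D` carries labels from `A` and `E` labels from `X`: if `d` is labelled `v` and `e` is labelled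
  -- `u`, all three edges of `u, d, e, v` get the label `s(u, v)`.
  set h : V → V := fun z => if z ∈ D then r z else if z ∈ E then q z else z with hh
  have fixA : ∀ x ∈ A, h x = x := fun x hx => by simp [hh, dAD hx, dAE hx]
  have fixB : ∀ x ∈ B, h x = x := fun x hx => by simp [hh, dBD hx, dBE hx]
  have fixX : ∀ x ∈ X, h x = x := fun x hx => by simp [hh, dCD (hX hx), dCE (hX hx)]
  have fix : ∀ x ∈ A ∪ B ∪ X, h x = x := by
    intro x hx
    simp only [Finset.mem_union] at hx
    rcases hx with (hx | hx) | hx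
    exacts [fixA x hx, fixB x hx, fixX x hx]
  have hsub : A ∪ B ∪ X ⊆ T :=
    Finset.union_subset (Finset.union_subset hA hB) (hX.trans hC)
  have direct : ∀ u ∈ A ∪ B ∪ X, ∀ v ∈ A ∪ B ∪ X, G.Adj u v →
      ∃ p : G.Walk u v, (∀ x ∈ p.support, x ∈ T) ∧ ∀ e ∈ p.edges, e.map h = s(u, v) := by
    intro u hu v hv huv
    refine ⟨huv.toWalk, ?_, ?_⟩
    · simp [hsub hu, hsub hv]
    · simp [fix u hu, fix v hv]
  have far : ∀ u ∈ X, ∀ v ∈ A,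
      ∃ p : G.Walk u v, (∀ x ∈ p.support, x ∈ T) ∧ ∀ e ∈ p.edges, e.map h = s(u, v) := by
    intro u hu v hv
    obtain ⟨d, hd, hrd⟩ := hr v hv
    obtain ⟨e, he, hqe⟩ := hq u hu
    have hhd : h d = v := by simp [hh, hd, hrd]
    have hhe : h e = u := by simp [hh, he, show e ∉ D from fun hd => dDE hd he, hqe]
    have h₁ : G.Adj u d := hCD u (by simp [hX hu]) d (by simp [hd])
      fun h => dCD (hX hu) (h ▸ hd)
    have h₂ : G.Adj d e := hDE d (by simp [hd]) e (by simp [he]) fun h => dDE hd (h ▸ he)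
    have h₃ : G.Adj e v := hEA e (by simp [he]) v (by simp [hv]) fun h => dAE hv (h ▸ he)
    refine ⟨.cons h₁ (.cons h₂ (.cons h₃ .nil)), ?_, ?_⟩
    · simp [hC (hX hu), hD hd, hE he, hA hv]
    · simp [hhd, hhe, fixX u hu, fixA v hv, Sym2.eq_swap]
  refine ⟨hsub, h, fix, fun u hu v hv huv => ?_⟩
  by_cases hadj : G.Adj u v
  · exact direct u hu v hv hadj
  by_cases huX : u ∈ X ∧ v ∈ A
  · exact far u huX.1 v huX.2
  by_cases hvX : v ∈ X ∧ u ∈ A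
  · obtain ⟨p, hp, hpe⟩ := far v hvX.1 u hvX.2
    refine ⟨p.reverse, by simpa using hp, fun e he => ?_⟩
    rw [hpe e (by simpa using he), Sym2.eq_swap]
  · exfalso
    simp only [Finset.mem_union] at hu hv hAB hBC
    rcases hu with (hu | hu) | hu <;> rcases hv with (hv | hv) | hv
    · exact hadj (hAB u (.inl hu) v (.inl hv) huv)
    · exact hadj (hAB u (.inl hu) v (.inr hv) huv)
    · exact hvX ⟨hv, hu⟩
    · exact hadj (hAB u (.inr hu) v (.inl hv) huv)
    · exact hadj (hAB u (.inr hu) v (.inr hv) huv)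
    · exact hadj (hBC u (.inl hu) v (.inr (hX hv)) huv)
    · exact huX ⟨hu, hv⟩
    · exact hadj (hBC u (.inr (hX hu)) v (.inl hv) huv)
    · exact hadj (hBC u (.inr (hX hu)) v (.inr (hX hv)) huv)

/-- If neither clique `D ∪ E` nor `C ∪ D` has half of `T`, then `|A| + |B| + |C|` and `|A| + |B| +
|E|` both exceed half, so `X ⊆ C` of size `min |C| |E|` suffices. -/
theorem exists_cliqueModelOn_of_cyclic [DecidableEq V] {T A B C D E : Finset V}
    (hA : A ⊆ T) (hB : B ⊆ T) (hC : C ⊆ T) (hD : D ⊆ T) (hE : E ⊆ T)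
    (hAB : ∀ u ∈ A ∪ B, ∀ v ∈ A ∪ B, u ≠ v → G.Adj u v)
    (hBC : ∀ u ∈ B ∪ C, ∀ v ∈ B ∪ C, u ≠ v → G.Adj u v)
    (hCD : ∀ u ∈ C ∪ D, ∀ v ∈ C ∪ D, u ≠ v → G.Adj u v)
    (hDE : ∀ u ∈ D ∪ E, ∀ v ∈ D ∪ E, u ≠ v → G.Adj u v)
    (hEA : ∀ u ∈ E ∪ A, ∀ v ∈ E ∪ A, u ≠ v → G.Adj u v)
    (dAB : Disjoint A B) (dAC : Disjoint A C) (dBC : Disjoint B C)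
    (dAD : Disjoint A D) (dAE : Disjoint A E) (dBD : Disjoint B D) (dBE : Disjoint B E)
    (dCD : Disjoint C D) (dCE : Disjoint C E) (dDE : Disjoint D E)
    (hT : T.card ≤ A.card + B.card + C.card + D.card + E.card) (hcard : A.card ≤ D.card) :
    ∃ S, T.card ≤ 2 * S.card ∧ G.CliqueModelOn T S := by
  by_cases h₁ : T.card ≤ 2 * (D ∪ E).card
  · exact ⟨_, h₁, .of_isClique (Finset.union_subset hD hE) hDE⟩
  by_cases h₂ : T.card ≤ 2 * (C ∪ D).card
  · exact ⟨_, h₂, .of_isClique (Finset.union_subset hC hD) hCD⟩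
  obtain ⟨X, hX, hXc⟩ := Finset.exists_subset_card_eq (Nat.min_le_left C.card E.card)
  refine ⟨A ∪ B ∪ X, ?_, .of_cyclic hA hB hC hD hE hAB hBC hCD hDE hEA dAD dAE dBD dBE dCD dCE dDE
    hcard hX (hXc.trans_le (Nat.min_le_right _ _))⟩
  have dX : Disjoint (A ∪ B) X :=
    Finset.disjoint_union_left.mpr ⟨dAC.mono_right hX, dBC.mono_right hX⟩
  rw [Finset.card_union_of_disjoint dX, Finset.card_union_of_disjoint dAB, hXc]
  rw [Finset.card_union_of_disjoint dDE] at h₁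
  rw [Finset.card_union_of_disjoint dCD] at h₂
  omega

/-! ### From labelled walks to an immersion -/

/-- The label of an edge determines the pair whose path uses it, which gives edge-disjointness. A
branch vertex on a path lies on one of its edges and is fixed by `h`, so it occurs in the label and
is an end. -/
theorem CliqueModelOn.containsImmersion {T S : Finset V} (h : G.CliqueModelOn T S) {m : ℕ}
    (hm : m ≤ S.card) : G.ContainsImmersion (completeGraph (Fin m)) := by
  classical
  obtain ⟨-, h, hfix, hp⟩ := h
  have hp' : ∀ u ∈ S, ∀ v ∈ S, u ≠ v →
      ∃ p : G.Walk u v, p.IsPath ∧ ∀ e ∈ p.edges, e.map h = s(u, v) := by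
    intro u hu v hv huv
    obtain ⟨p, -, hpe⟩ := hp u hu v hv huv
    exact ⟨p.bypass, p.bypass_isPath, fun e he => hpe e (p.edges_bypass_subset_edges he)⟩
  let φ : Fin m → V := fun i => (S.equivFin.symm (Fin.castLE hm i)).1
  have φS : ∀ i, φ i ∈ S := fun i => (S.equivFin.symm (Fin.castLE hm i)).2
  have φinj : Function.Injective φ :=
    Subtype.val_injective.comp (S.equivFin.symm.injective.comp (Fin.castLE_injective hm))
  choose Q hQpath hQedge using
    fun (i j : Fin m) (hij : i ≠ j) => hp' (φ i) (φS i) (φ j) (φS j) (φinj.ne hij)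
  let P : ∀ i j : Fin m, (completeGraph (Fin m)).Adj i j → G.Walk (φ i) (φ j) := fun i j hij =>
    if i < j then Q i j hij.ne else (Q j i hij.ne').reverse
  have Pedge : ∀ i j hij, ∀ e ∈ (P i j hij).edges, e.map h = s(φ i, φ j) := by
    intro i j hij e he
    by_cases hlt : i < j
    · simp only [P, if_pos hlt] at he
      exact hQedge i j hij.ne e he
    · simp only [P, if_neg hlt, Walk.edges_reverse, List.mem_reverse] at he
      rw [hQedge j i hij.ne' e he, Sym2.eq_swap]
  refine ⟨φ, P, φinj, ?_, ?_, ?_, ?_⟩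
  · intro i j hij
    rcases lt_or_gt_of_ne hij.ne with hlt | hlt
    · simp [P, hlt, hlt.not_gt]
    · simp [P, hlt, hlt.not_gt]
  · intro i j hij
    by_cases hlt : i < j
    · simpa only [P, if_pos hlt] using hQpath i j hij.ne
    · simpa only [P, if_neg hlt] using (hQpath j i hij.ne').reverse
  · intro i j i' j' hij hij' hne e he he'
    refine hne (Sym2.map.injective φinj ?_)
    rw [Sym2.map_mk, Sym2.map_mk, ← Pedge i j hij e he, ← Pedge i' j' hij' e he']
  · intro i j hij k hk
    have hnil : ¬ (P i j hij).Nil := Walk.not_nil_of_ne (φinj.ne hij.ne)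
    obtain ⟨e, he, hke⟩ := (Walk.mem_support_iff_exists_mem_edges_of_not_nil hnil).mp hk
    have : h (φ k) ∈ e.map h := Sym2.mem_map.mpr ⟨_, hke, rfl⟩
    rw [Pedge i j hij e he, hfix _ (φS k)] at this
    exact Sym2.mem_iff.mp this

/-! ### Forbidden subgraphs of the complement -/

theorem not_adj_compl_triangle (hα : Gᶜ.CliqueFree 3) {a b c : V} (hab : Gᶜ.Adj a b)
    (hbc : Gᶜ.Adj b c) (hac : Gᶜ.Adj a c) : False := by
  classical
  exact hα {a, b, c} (is3Clique_triple_iff.mpr ⟨hab, hac, hbc⟩)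

theorem houseGraph_isIndContained {a b c d e : V} (hab : Gᶜ.Adj a b) (hbc : Gᶜ.Adj b c)
    (hcd : Gᶜ.Adj c d) (hde : Gᶜ.Adj d e) (hac : ¬ Gᶜ.Adj a c) (had : ¬ Gᶜ.Adj a d)
    (hae : ¬ Gᶜ.Adj a e) (hbd : ¬ Gᶜ.Adj b d) (hbe : ¬ Gᶜ.Adj b e) (hce : ¬ Gᶜ.Adj c e) :
    houseGraph.IsIndContained G := by
  have nac : a ≠ c := by rintro rfl; exact had hcd
  have nad : a ≠ d := by rintro rfl; exact hae hde
  have nae : a ≠ e := by rintro rfl; exact had hde.symm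
  have nbd : b ≠ d := by rintro rfl; exact hbe hde
  have nbe : b ≠ e := by rintro rfl; exact hae hab
  have nce : c ≠ e := by rintro rfl; exact hbe hbc
  simp only [compl_adj, not_and, not_not] at *
  replace hac := hac nac
  replace had := had nad
  replace hae := hae nae
  replace hbd := hbd nbd
  replace hbe := hbe nbe
  replace hce := hce nce
  -- The middle vertex `c` of the complement path is the roof, resting on the two ends `a` and `e`.
  refine ⟨⟨⟨![a, e, b, d, c], ?_⟩, ?_⟩⟩
  · intro i j hij
    fin_cases i <;> fin_cases j <;> simp_all [eq_comm]
  · intro i j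
    change G.Adj (![a, e, b, d, c] i) (![a, e, b, d, c] j) ↔ _
    fin_cases i <;> fin_cases j <;> simp_all [houseGraph, G.adj_comm]

/-- The complement of `G` contains neither a triangle nor an induced path on five vertices. -/
structure ComplTriangleP5Free (G : SimpleGraph V) : Prop where
  triangle : ∀ {a b c}, Gᶜ.Adj a b → Gᶜ.Adj b c → ¬ Gᶜ.Adj a c
  -- The chords `ac`, `bd`, `ce` would close triangles, so only `ad`, `be` and `ae` have to be
  -- mentioned.
  path : ∀ {a b c d e}, Gᶜ.Adj a b → Gᶜ.Adj b c → Gᶜ.Adj c d → Gᶜ.Adj d e →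
    ¬ Gᶜ.Adj a d → ¬ Gᶜ.Adj b e → Gᶜ.Adj a e

theorem ComplTriangleP5Free.of_houseFree (hhouse : ¬ houseGraph.IsIndContained G)
    (hα : G.indepNum ≤ 2) [Finite V] : G.ComplTriangleP5Free := by
  have hfree : Gᶜ.CliqueFree 3 := by
    cases nonempty_fintype V
    intro s hs
    have h := (G.isClique_compl).mp hs.isClique
    have := h.card_le_indepNum
    have := hs.card_eq
    omega
  refine ⟨fun h₁ h₂ h₃ => not_adj_compl_triangle hfree h₁ h₂ h₃, ?_⟩
  intro a b c d e hab hbc hcd hde had hbe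
  by_contra hae
  exact hhouse (houseGraph_isIndContained hab hbc hcd hde
    (fun h => not_adj_compl_triangle hfree hab hbc h) had hae
    (fun h => not_adj_compl_triangle hfree hbc hcd h) hbe
    (fun h => not_adj_compl_triangle hfree hcd hde h))

theorem adj_of_not_compl_adj {u v : V} (huv : u ≠ v) (h : ¬ Gᶜ.Adj u v) : G.Adj u v := by
  by_contra hn
  exact h ((G.compl_adj u v).mpr ⟨huv, hn⟩)

/-! ### The two kinds of components of the complement -/

/-- Around a 5-cycle of the complement, the vertices of `T` attached to the cycle form a cyclic
system of five cliques that is completely joined to the rest of `T`. -/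
theorem ComplTriangleP5Free.exists_of_cycle (hG : G.ComplTriangleP5Free) {T : Finset V}
    (c : Fin 5 → V) (hcT : ∀ i, c i ∈ T) (hc : ∀ i, Gᶜ.Adj (c i) (c (i + 1))) :
    ∃ U S, U ⊆ T ∧ U.Nonempty ∧ (∀ u ∈ U, ∀ v ∈ T, Gᶜ.Adj u v → v ∈ U) ∧
      U.card ≤ 2 * S.card ∧ G.CliqueModelOn U S := by
  classical
  have i41 : ∀ i : Fin 5, i + 4 + 1 = i := by decide
  have i14 : ∀ i : Fin 5, i + 1 + 4 = i := by decide
  have i11 : ∀ i : Fin 5, i + 1 + 1 = i + 2 := by decide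
  have i21 : ∀ i : Fin 5, i + 2 + 1 = i + 3 := by decide
  have i31 : ∀ i : Fin 5, i + 3 + 1 = i + 4 := by decide
  have i24 : ∀ i : Fin 5, i + 2 + 4 = i + 1 := by decide
  have i44 : ∀ i : Fin 5, i + 4 + 4 = i + 3 := by decide
  have i22 : ∀ i : Fin 5, i + 2 + 2 = i + 4 := by decide
  have i42 : ∀ i : Fin 5, i + 4 + 2 = i + 1 := by decide
  have i12 : ∀ i : Fin 5, i + 1 + 2 = i + 3 := by decide
  have i32 : ∀ i : Fin 5, i + 3 + 2 = i := by decide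
  -- Here `i + 4` is `i - 1`. Both `A i` and `A (i + 2)` lie in the complement neighbourhood of `c
  -- (i + 1)`, hence their union is independent in the complement.
  let A : Fin 5 → Finset V := fun i => T.filter fun u => Gᶜ.Adj u (c (i + 4)) ∧ Gᶜ.Adj u (c (i + 1))
  have memA : ∀ i u, u ∈ A i ↔ u ∈ T ∧ Gᶜ.Adj u (c (i + 4)) ∧ Gᶜ.Adj u (c (i + 1)) := by
    simp [A]
  have indep : ∀ i, ∀ u ∈ A i, ∀ v ∈ A i, ¬ Gᶜ.Adj u v := fun i u hu v hv =>
    hG.triangle ((memA i u).mp hu).2.2 ((memA i v).mp hv).2.2.symm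
  have indep₂ : ∀ i, ∀ u ∈ A i, ∀ v ∈ A (i + 2), ¬ Gᶜ.Adj u v := fun i u hu v hv =>
    hG.triangle ((memA i u).mp hu).2.2 (i24 i ▸ ((memA _ v).mp hv).2.1.symm)
  have clique : ∀ i j, j = i + 2 → ∀ u ∈ A i ∪ A j, ∀ v ∈ A i ∪ A j, u ≠ v → G.Adj u v := by
    rintro i _ rfl u hu v hv huv
    apply adj_of_not_compl_adj huv
    rcases Finset.mem_union.mp hu with hu | hu <;> rcases Finset.mem_union.mp hv with hv | hv
    · exact indep i u hu v hv
    · exact indep₂ i u hu v hv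
    · exact fun h => indep₂ i v hv u hu h.symm
    · exact indep _ u hu v hv
  have disj₁ : ∀ i j, j = i + 1 → Disjoint (A i) (A j) := by
    rintro i _ rfl
    refine Finset.disjoint_left.mpr fun u hu hu' => ?_
    have h := ((memA _ u).mp hu').2.1
    rw [i14] at h
    exact hG.triangle h (hc i) ((memA i u).mp hu).2.2
  have disj₂ : ∀ i j, j = i + 2 → Disjoint (A i) (A j) := by
    rintro i _ rfl
    refine Finset.disjoint_left.mpr fun u hu hu' => ?_
    have h := ((memA _ u).mp hu').2.2
    have h' := hc (i + 3)
    rw [i21] at h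
    rw [i31] at h'
    exact hG.triangle h h' ((memA i u).mp hu).2.1
  have selfmem : ∀ i, c i ∈ A i := fun i => by
    have := hc (i + 4)
    rw [i41] at this
    exact (memA _ _).mpr ⟨hcT i, this.symm, hc i⟩
  have attach : ∀ v ∈ T, ∀ i, Gᶜ.Adj v (c i) → ∃ j, v ∈ A j := by
    intro v hv i hvi
    by_contra! hno
    have h₁ := hc (i + 1)
    have h₂ := hc (i + 2)
    have h₃ := hc (i + 3)
    have h₄ := hc (i + 4)
    rw [i11] at h₁
    rw [i21] at h₂
    rw [i31] at h₃
    rw [i41] at h₄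
    -- The path `v, c i, …, c (i + 3)` is not induced: a chord to `c (i + 2)` puts `v` in `A (i +
    -- 1)`, and a chord to `c (i + 3)` puts it in `A (i + 4)`.
    refine hno (i + 4) ((memA _ _).mpr ⟨hv, ?_, by rwa [i41]⟩)
    rw [i44]
    refine hG.path hvi (hc i) h₁ h₂ (fun h => ?_) fun h => hG.triangle h₃ h₄ h.symm
    exact hno (i + 1) ((memA _ _).mpr ⟨hv, by rwa [i14], by rwa [i11]⟩)
  have closed : ∀ i, ∀ u ∈ A i, ∀ v ∈ T, Gᶜ.Adj u v → ∃ j, v ∈ A j := by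
    intro i u hu v hv huv
    by_contra hno
    have hfar : ∀ j, ¬ Gᶜ.Adj v (c j) := fun j hj => hno (attach v hv j hj)
    have h₁ := hc (i + 1)
    have h₂ := hc (i + 2)
    have h₃ := hc (i + 3)
    rw [i11] at h₁
    rw [i21] at h₂
    rw [i31] at h₃
    obtain ⟨-, hu₁, hu₂⟩ := (memA _ _).mp hu
    -- Otherwise `v, u, c (i + 1), c (i + 2), c (i + 3)` would be an induced path.
    exact hfar _ (hG.path huv.symm hu₂ h₁ h₂ (hfar _) fun h => hG.triangle h h₃ hu₁)
  have hsub : ∀ i, A i ⊆ Finset.univ.biUnion A :=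
    fun i => Finset.subset_biUnion_of_mem A (Finset.mem_univ i)
  obtain ⟨j, hj⟩ : ∃ j, (A j).card ≤ (A (j + 1)).card := by
    obtain ⟨j, -, hj⟩ := Finset.exists_min_image Finset.univ (fun i => (A i).card) ⟨0, by simp⟩
    exact ⟨j, hj _ (Finset.mem_univ _)⟩
  have hcard : (Finset.univ.biUnion A).card ≤ (A j).card + (A (j + 2)).card + (A (j + 4)).card +
      (A (j + 1)).card + (A (j + 3)).card := by
    refine Finset.card_biUnion_le.trans (le_of_eq ?_)
    rw [← Equiv.sum_comp (Equiv.addLeft j), Fin.sum_univ_five]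
    simp only [Equiv.coe_addLeft, add_zero]
    ring
  -- Steps of two turn the cyclic order of the complement into that of the cliques: `A, B, C, D, E`
  -- have indices `j, j + 2, j + 4, j + 1, j + 3`, and `hj` is `|A| ≤ |D|`.
  obtain ⟨S, hS, hmodel⟩ := exists_cliqueModelOn_of_cyclic (G := G) (hsub j) (hsub (j + 2))
    (hsub (j + 4)) (hsub (j + 1)) (hsub (j + 3)) (clique _ _ rfl) (clique _ _ (i22 j).symm)
    (clique _ _ (i42 j).symm) (clique _ _ (i12 j).symm) (clique _ _ (i32 j).symm)
    (disj₂ _ _ rfl) (disj₁ _ _ (i41 j).symm).symm (disj₂ _ _ (i22 j).symm)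
    (disj₁ _ _ rfl) (disj₂ _ _ (i32 j).symm).symm (disj₁ _ _ (i11 j).symm).symm
    (disj₁ _ _ (i21 j).symm) (disj₂ _ _ (i42 j).symm) (disj₁ _ _ (i31 j).symm).symm
    (disj₂ _ _ (i12 j).symm) hcard hj
  refine ⟨_, S, ?_, ⟨c 0, hsub 0 (selfmem 0)⟩, ?_, hS, hmodel⟩
  · exact Finset.biUnion_subset.mpr fun i _ => Finset.filter_subset _ _
  · intro u hu v hv huv
    obtain ⟨i, -, hi⟩ := Finset.mem_biUnion.mp hu
    obtain ⟨k, hk⟩ := closed i u hi v hv huv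
    exact hsub k hk

/-- If the complement has no 5-cycle inside `T`, the component of a vertex in the complement is
bipartite by distance layers, and the larger side is a clique of `G`. -/
theorem ComplTriangleP5Free.exists_of_no_cycle (hG : G.ComplTriangleP5Free) {T : Finset V}
    (hno : ¬ ∃ c : Fin 5 → V, (∀ i, c i ∈ T) ∧ ∀ i, Gᶜ.Adj (c i) (c (i + 1)))
    {v : V} (hv : v ∈ T) :
    ∃ U S, U ⊆ T ∧ U.Nonempty ∧ (∀ u ∈ U, ∀ v ∈ T, Gᶜ.Adj u v → v ∈ U) ∧
      U.card ≤ 2 * S.card ∧ G.CliqueModelOn U S := by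
  classical
  -- Since `c` need not be injective, `hno` excludes every closed walk of length five, and `p, x, y,
  -- q` need no distinctness.
  have no5 : ∀ p x y q, p ∈ T → x ∈ T → y ∈ T → q ∈ T → Gᶜ.Adj v p → Gᶜ.Adj p x → Gᶜ.Adj x y →
      Gᶜ.Adj y q → ¬ Gᶜ.Adj q v := by
    intro p x y q hp hx hy hq h₁ h₂ h₃ h₄ h₅
    refine hno ⟨![v, p, x, y, q], ?_, ?_⟩
    · intro i
      fin_cases i <;> assumption
    · intro i
      fin_cases i <;> assumption
  let N₁ := T.filter fun u => Gᶜ.Adj v u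
  let N₂ := T.filter fun u => ¬ Gᶜ.Adj v u ∧ u ≠ v ∧ ∃ p ∈ N₁, Gᶜ.Adj p u
  let N₃ := T.filter fun u => ¬ Gᶜ.Adj v u ∧ u ≠ v ∧ u ∉ N₂ ∧ ∃ p ∈ N₂, Gᶜ.Adj p u
  have mem₁ : ∀ u, u ∈ N₁ ↔ u ∈ T ∧ Gᶜ.Adj v u := by simp [N₁]
  have mem₂ : ∀ u, u ∈ N₂ ↔ u ∈ T ∧ ¬ Gᶜ.Adj v u ∧ u ≠ v ∧ ∃ p ∈ N₁, Gᶜ.Adj p u := by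
    intro u; simp only [N₂, Finset.mem_filter]
  have mem₃ : ∀ u, u ∈ N₃ ↔ u ∈ T ∧ ¬ Gᶜ.Adj v u ∧ u ≠ v ∧ u ∉ N₂ ∧ ∃ p ∈ N₂, Gᶜ.Adj p u := by
    intro u; simp only [N₃, Finset.mem_filter]
  clear_value N₁ N₂ N₃
  -- a vertex adjacent to the third layer lies in the first or second layer
  have third : ∀ x ∈ N₃, ∀ y ∈ T, Gᶜ.Adj x y → y ∈ N₁ ∨ y = v ∨ y ∈ N₂ := by
    intro x hx y hy hxy
    by_contra! hcon
    obtain ⟨c₁, c₂, c₃⟩ := hcon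
    obtain ⟨-, hx₁, -, -, p, hp, hpx⟩ := (mem₃ x).mp hx
    obtain ⟨-, -, -, r, hr, hrp⟩ := (mem₂ p).mp hp
    obtain ⟨-, hvr⟩ := (mem₁ r).mp hr
    have hvy : ¬ Gᶜ.Adj v y := fun h => c₁ ((mem₁ y).mpr ⟨hy, h⟩)
    -- The path `y, x, p, r, v` would be induced, so there is no fourth layer and no edge inside the
    -- third.
    refine hvy (hG.path hxy.symm hpx.symm hrp.symm hvr.symm (fun h => ?_) fun h => hx₁ h.symm).symm
    exact c₃ ((mem₂ y).mpr ⟨hy, hvy, c₂, r, hr, h.symm⟩)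
  have hE : ∀ x ∈ insert v N₂, ∀ y ∈ insert v N₂, x ≠ y → G.Adj x y := by
    intro x hx y hy hxy
    refine adj_of_not_compl_adj hxy fun h => ?_
    rcases Finset.mem_insert.mp hx with rfl | hx' <;> rcases Finset.mem_insert.mp hy with rfl | hy'
    · exact hxy rfl
    · exact ((mem₂ y).mp hy').2.1 h
    · exact ((mem₂ x).mp hx').2.1 h.symm
    · obtain ⟨hxT, -, -, p, hp, hpx⟩ := (mem₂ x).mp hx'
      obtain ⟨hyT, -, -, q, hq, hqy⟩ := (mem₂ y).mp hy'
      obtain ⟨hpT, hvp⟩ := (mem₁ p).mp hp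
      obtain ⟨hqT, hvq⟩ := (mem₁ q).mp hq
      exact no5 p x y q hpT hxT hyT hqT hvp hpx h hqy.symm hvq.symm
  have h13 : ∀ x ∈ N₁, ∀ y ∈ N₃, ¬ Gᶜ.Adj x y := by
    intro x hx y hy h
    obtain ⟨hyT, hy₁, hy₂, hy₃, -⟩ := (mem₃ y).mp hy
    exact hy₃ ((mem₂ y).mpr ⟨hyT, hy₁, hy₂, x, hx, h⟩)
  have hO : ∀ x ∈ N₁ ∪ N₃, ∀ y ∈ N₁ ∪ N₃, x ≠ y → G.Adj x y := by
    intro x hx y hy hxy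
    refine adj_of_not_compl_adj hxy fun h => ?_
    rcases Finset.mem_union.mp hx with hx | hx <;> rcases Finset.mem_union.mp hy with hy | hy
    · exact hG.triangle ((mem₁ x).mp hx).2 h ((mem₁ y).mp hy).2
    · exact h13 x hx y hy h
    · exact h13 y hy x hx h.symm
    · obtain ⟨hyT, hy₁, hy₂, hy₃, -⟩ := (mem₃ y).mp hy
      rcases third x hx y hyT h with h' | h' | h'
      exacts [hy₁ ((mem₁ y).mp h').2, hy₂ h', hy₃ h']
  have hsub : insert v N₂ ∪ (N₁ ∪ N₃) ⊆ T := by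
    intro x hx
    simp only [Finset.mem_union, Finset.mem_insert] at hx
    rcases hx with (rfl | hx) | hx | hx
    exacts [hv, ((mem₂ x).mp hx).1, ((mem₁ x).mp hx).1, ((mem₃ x).mp hx).1]
  have hclosed : ∀ u ∈ insert v N₂ ∪ (N₁ ∪ N₃), ∀ w ∈ T, Gᶜ.Adj u w →
      w ∈ insert v N₂ ∪ (N₁ ∪ N₃) := by
    intro u hu w hw huw
    simp only [Finset.mem_union, Finset.mem_insert] at hu ⊢
    by_contra! hcon
    obtain ⟨⟨c₀, c₂⟩, c₁, c₃⟩ := hcon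
    have hvw : ¬ Gᶜ.Adj v w := fun h => c₁ ((mem₁ w).mpr ⟨hw, h⟩)
    rcases hu with (rfl | hu) | hu | hu
    · exact hvw huw
    · exact c₃ ((mem₃ w).mpr ⟨hw, hvw, c₀, c₂, u, hu, huw⟩)
    · exact c₂ ((mem₂ w).mpr ⟨hw, hvw, c₀, u, hu, huw⟩)
    · rcases third u hu w hw huw with h | h | h
      exacts [c₁ h, c₀ h, c₂ h]
  have hcard := Finset.card_union_le (insert v N₂) (N₁ ∪ N₃)
  have hne : (insert v N₂ ∪ (N₁ ∪ N₃)).Nonempty := ⟨v, by simp⟩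
  rcases le_total (insert v N₂).card (N₁ ∪ N₃).card with hle | hle
  · exact ⟨_, _, hsub, hne, hclosed, by omega, .of_isClique Finset.subset_union_right hO⟩
  · exact ⟨_, _, hsub, hne, hclosed, by omega, .of_isClique Finset.subset_union_left hE⟩

/-! ### Assembling the components -/

/-- Splitting off a set `U` closed under complement adjacency in `T` leaves `U` completely joined in
`G` to `T \ U`, so the two models join and their bounds add. -/
theorem ComplTriangleP5Free.exists_cliqueModelOn (hG : G.ComplTriangleP5Free) (T : Finset V) :
    ∃ S, T.card ≤ 2 * S.card ∧ G.CliqueModelOn T S := by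
  classical
  induction T using Finset.strongInduction with
  | H T ih =>
    rcases T.eq_empty_or_nonempty with rfl | ⟨v, hv⟩
    · exact ⟨∅, by simp, .of_isClique subset_rfl (by simp)⟩
    obtain ⟨U, S₁, hUT, hUne, hclosed, hcard₁, hmodel₁⟩ :
        ∃ U S, U ⊆ T ∧ U.Nonempty ∧ (∀ u ∈ U, ∀ v ∈ T, Gᶜ.Adj u v → v ∈ U) ∧
          U.card ≤ 2 * S.card ∧ G.CliqueModelOn U S := by
      by_cases h : ∃ c : Fin 5 → V, (∀ i, c i ∈ T) ∧ ∀ i, Gᶜ.Adj (c i) (c (i + 1))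
      · obtain ⟨c, hcT, hc⟩ := h
        exact hG.exists_of_cycle c hcT hc
      · exact hG.exists_of_no_cycle h hv
    obtain ⟨S₂, hcard₂, hmodel₂⟩ := ih (T \ U) (Finset.sdiff_ssubset hUT hUne)
    have hdisj : Disjoint U (T \ U) := Finset.disjoint_sdiff
    have hmodel := hmodel₁.join hmodel₂ hdisj fun u hu w hw => by
      obtain ⟨hwT, hwU⟩ := Finset.mem_sdiff.mp hw
      exact adj_of_not_compl_adj (fun h => hwU (h ▸ hu)) fun h => hwU (hclosed u hu w hwT h)
    rw [Finset.union_sdiff_of_subset hUT] at hmodel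
    refine ⟨_, ?_, hmodel⟩
    rw [Finset.card_union_of_disjoint (hdisj.mono hmodel₁.1 hmodel₂.1)]
    have := Finset.card_sdiff_add_card_eq_card hUT
    omega

end SimpleGraph

theorem mainTheorem5 {V : Type*} [Fintype V] (G : SimpleGraph V)
    (hhouse : ¬ houseGraph.IsIndContained G) (hα : G.indepNum ≤ 2) :
    G.ContainsImmersion (SimpleGraph.completeGraph (Fin ⌈(Fintype.card V : ℚ) / 2⌉₊)) := by
  obtain ⟨S, hS, hmodel⟩ :=
    (SimpleGraph.ComplTriangleP5Free.of_houseFree hhouse hα).exists_cliqueModelOn Finset.univ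
  refine hmodel.containsImmersion (Nat.ceil_le.mpr ?_)
  rw [div_le_iff₀ two_pos, mul_comm]
  exact_mod_cast hS
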